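/- Let $f \in \mathbb{R}\setminus\mathbb{Z}$. Let $R_f(\mathbb{R},\mathbb{Z})$ be the convex hull, in the space of finitely supported functions $\mathbb{R}\to\mathbb{R}$, of the set $X_f$ of all finitely supported functions $y\colon\mathbb{R}\to\mathbb{Z}_{\ge 0}$ with $\sum_{r\in\mathbb{R}} r\,y(r)\in f+\mathbb{Z}$. A function $\pi\colon\mathbb{R}\to\mathbb{R}$ is called *valid* if $\pi\ge 0$ and $\sum_{r\in\mathbb{R}}\pi(r)y(r)\ge 1$ for all $y\in R_f(\mathbb{R},\mathbb{Z})$. A valid function $\pi$ is called *extreme* if $\pi=\tfrac12(\pi^1+\pi^2)$ with valid functions $\pi^1,\pi^2$ implies $\pi=\pi^1=\pi^2$. For a valid function $\pi$ let $P(\pi)$ be the set of all $y\in X_f$ with $\sum_{r\in\mathbb{R}}\pi(r)y(r)=1$; a valid function $\pi$ is called a *facet* if $\pi'=\pi$ for every valid function $\pi'$ with $P(\pi)\subseteq P(\pi')$. **Proposition.** Let $q\ge 1$ be an integer, and let $\pi\colon\mathbb{R}\to\mathbb{R}$ be a continuous piecewise linear function with breakpoints in $\tfrac1q\mathbb{Z}$,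 that is, $\pi$ is affine on each interval $\left[\tfrac{i}{q},\tfrac{i+1}{q}\right]$, $i\in\mathbb{Z}$. Then $\pi$ is extreme if and only if $\pi$ is a facet. -/

import Mathlib

namespace GroupProblem

/-- The solution set of the group problem for an abelian group `G`, a subgroup `S` and `f : G`:
all finitely supported `y : G → ℝ` with values in the nonnegative integers such that
`∑ r, y r • r ∈ f + S`.  The integer values of `y` are recorded by `n : G →₀ ℕ`. -/
def feasible {G : Type*} [AddCommGroup G] (f : G) (S : AddSubgroup G) : Set (G →₀ ℝ) :=
  {y | ∃ n : G →₀ ℕ, (∀ r, y r = (n r : ℝ)) ∧ ∃ s ∈ S, (n.sum fun r k => k • r) = f + s}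

/-- `R_f(G, S)`: the convex hull of the solution set, in the space `ℝ^(G)` of finitely supported
functions. -/
def relaxation {G : Type*} [AddCommGroup G] (f : G) (S : AddSubgroup G) : Set (G →₀ ℝ) :=
  convexHull ℝ (feasible f S)

/-- The left-hand side `∑ r, π r * y r` of the inequality with coefficient function `π`. -/
def lhs {G : Type*} (π : G → ℝ) (y : G →₀ ℝ) : ℝ :=
  y.sum fun r t => π r * t

/-- `π` is a valid function for `R_f(G, S)`: `π ≥ 0` and `∑ r, π r * y r ≥ 1` on `R_f(G, S)`. -/
def IsValid {G : Type*} [AddCommGroup G] (f : G) (S : AddSubgroup G) (π : G → ℝ) : Prop :=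
  (∀ r, 0 ≤ π r) ∧ ∀ y ∈ relaxation f S, 1 ≤ lhs π y

/-- `π` is extreme for `R_f(G, S)`: it is valid, and `π = (π₁ + π₂) / 2` with `π₁`, `π₂` valid
implies `π = π₁ = π₂`. -/
def IsExtreme {G : Type*} [AddCommGroup G] (f : G) (S : AddSubgroup G) (π : G → ℝ) : Prop :=
  IsValid f S π ∧ ∀ π₁ π₂ : G → ℝ, IsValid f S π₁ → IsValid f S π₂ →
    (∀ r, π r = (1 / 2 : ℝ) * (π₁ r + π₂ r)) → π = π₁ ∧ π = π₂

/-- `P(π)`: the feasible solutions `y` at which the inequality given by `π` is tight. -/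
def tightSet {G : Type*} [AddCommGroup G] (f : G) (S : AddSubgroup G) (π : G → ℝ) :
    Set (G →₀ ℝ) :=
  {y | y ∈ feasible f S ∧ lhs π y = 1}

/-- `π` is a facet of `R_f(G, S)`: it is valid, and the only valid `π'` with `P(π) ⊆ P(π')`
is `π` itself. -/
def IsFacet {G : Type*} [AddCommGroup G] (f : G) (S : AddSubgroup G) (π : G → ℝ) : Prop :=
  IsValid f S π ∧ ∀ π' : G → ℝ, IsValid f S π' → tightSet f S π ⊆ tightSet f S π' → π' = π

/-- The integers as a subgroup of the real line. -/
def integers : AddSubgroup ℝ := (Int.castAddHom ℝ).range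

/-- `π` is affine over `U`: it has a gradient `c` there. -/
def IsAffineOver (π : ℝ → ℝ) (U : Set ℝ) : Prop :=
  ∃ c : ℝ, ∀ u₁ ∈ U, ∀ u₂ ∈ U, π u₂ - π u₁ = c * (u₂ - u₁)

/-- `π` is continuous piecewise linear with breakpoints in `(1/q)ℤ`: it is affine over each of the
closed cells `[i/q, (i+1)/q]`, `i ∈ ℤ`, of the one-dimensional complex with vertex set `(1/q)ℤ`.
Not every vertex has to be a point where the slope changes.  Continuity follows for `q ≥ 1` because
the cells are closed, cover the line and are locally finite. -/
def IsContinuousPiecewiseLinear (q : ℕ) (π : ℝ → ℝ) : Prop :=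
  ∀ i : ℤ, IsAffineOver π (Set.Icc ((i : ℝ) / (q : ℝ)) (((i : ℝ) + 1) / (q : ℝ)))

end GroupProblem

namespace GroupProblem

open Finsupp (linearCombination single)

/-! ### Valid, minimal and extreme functions over an arbitrary abelian group. -/

section Group

variable {G : Type*} {π π' : G → ℝ}

/-! A facet is extreme because two numbers that are at least 1 and average to 1 are both 1.
Conversely, an extreme `π` is minimal, hence subadditive, periodic and symmetric, and each
additivity relation of `π` completes to a tight solution. If `P(π) ⊆ P(π')`, the difference `ψ` of
`π'` and `π` therefore respects all these relations, and the goal is `ψ = 0`.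

A periodic grid function that respects the additivities of `π` and vanishes at `f` can be scaled
down, interpolated, and both added to and subtracted from `π`; extremality forces it to be zero
(`IsExtreme.grid_rigidity`). This needs `f` on the grid, which `IsExtreme.exists_grid` supplies. On
the grid `1/(4q)` it kills `ψ` at the grid points, but `ψ` need not be piecewise linear in between.
So `ψ` is traded for a grid function, `cellZigzag`, which puts one fixed odd zigzag on every cell
where `ψ` is not identically zero. It respects the same relations (`cellZigzag_add`), so it
vanishes, and no such cell exists. -/

theorem lhs_mapRange (π : G → ℝ) (n : G →₀ ℕ) :
    lhs π (n.mapRange (Nat.cast : ℕ → ℝ) Nat.cast_zero) = linearCombination ℕ π n := by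
  rw [lhs, Finsupp.sum_mapRange_index (by simp), Finsupp.linearCombination_apply]
  exact Finsupp.sum_congr fun r _ => by rw [nsmul_eq_mul, mul_comm]

theorem lhs_eq_linearCombination (π : G → ℝ) (y : G →₀ ℝ) :
    lhs π y = linearCombination ℝ π y := by
  rw [lhs, Finsupp.linearCombination_apply]
  exact Finsupp.sum_congr fun r _ => by rw [smul_eq_mul, mul_comm]

theorem linearCombination_mono (h : ∀ r, π r ≤ π' r) (n : G →₀ ℕ) :
    linearCombination ℕ π n ≤ linearCombination ℕ π' n := by
  simp only [Finsupp.linearCombination_apply]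
  exact Finset.sum_le_sum fun r _ => nsmul_le_nsmul_right (h r) _

theorem linearCombination_erase_add {M : Type*} [AddCommMonoid M] (v : G → M) (n : G →₀ ℕ)
    (r : G) : linearCombination ℕ v n = linearCombination ℕ v (n.erase r) + n r • v r := by
  conv_lhs => rw [← Finsupp.erase_add_single r n, map_add, Finsupp.linearCombination_single]

theorem linearCombination_update_erase [DecidableEq G] (n : G →₀ ℕ) (r : G) (c : ℝ) :
    linearCombination ℕ (Function.update π r c) (n.erase r) =
      linearCombination ℕ π (n.erase r) := by
  simp only [Finsupp.linearCombination_apply]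
  refine Finsupp.sum_congr fun x hx => ?_
  have : x ≠ r := by
    rintro rfl
    simp at hx
  rw [Function.update_of_ne this]

variable [AddCommGroup G] {f : G} {S : AddSubgroup G}

/-- Every feasible point is the image of an integer vector `n` with `∑ n r • r ∈ f + S`. -/
theorem mem_feasible_iff {y : G →₀ ℝ} :
    y ∈ feasible f S ↔ ∃ n : G →₀ ℕ, n.mapRange (Nat.cast : ℕ → ℝ) Nat.cast_zero = y ∧
      linearCombination ℕ id n - f ∈ S := by
  constructor
  · rintro ⟨n, hn, s, hs, h⟩
    refine ⟨n, Finsupp.ext fun r => by simp [hn r], ?_⟩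
    have h' : linearCombination ℕ id n = f + s := h
    simpa [h'] using hs
  · rintro ⟨n, rfl, h⟩
    exact ⟨n, fun r => by simp, _, h, by simp [Finsupp.linearCombination_apply]⟩

/-- A half-space is convex, so the inequality passes from integer solutions to their hull. -/
theorem isValid_iff : IsValid f S π ↔
    (∀ r, 0 ≤ π r) ∧ ∀ n : G →₀ ℕ, linearCombination ℕ id n - f ∈ S →
      1 ≤ linearCombination ℕ π n := by
  refine and_congr_right fun _ => ⟨fun h n hn => ?_, fun h y hy => ?_⟩
  · rw [← lhs_mapRange]
    exact h _ (subset_convexHull ℝ _ (mem_feasible_iff.2 ⟨n, rfl, hn⟩))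
  · have hc : Convex ℝ {y : G →₀ ℝ | 1 ≤ linearCombination ℝ π y} :=
      convex_halfSpace_ge (linearCombination ℝ π).isLinear 1
    rw [lhs_eq_linearCombination]
    refine convexHull_min ?_ hc hy
    intro z hz
    obtain ⟨n, rfl, hn⟩ := mem_feasible_iff.1 hz
    rw [Set.mem_ofPred_eq, ← lhs_eq_linearCombination, lhs_mapRange]
    exact h n hn

theorem IsFacet.isExtreme (h : IsFacet f S π) : IsExtreme f S π := by
  refine ⟨h.1, fun π₁ π₂ h₁ h₂ hπ => ?_⟩
  have hn : ∀ y, lhs π y = (1 / 2 : ℝ) * (lhs π₁ y + lhs π₂ y) := fun y => by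
    simp only [lhs, Finsupp.sum, ← Finset.sum_add_distrib, Finset.mul_sum, hπ]
    exact Finset.sum_congr rfl fun r _ => by ring
  refine ⟨(h.2 π₁ h₁ fun y hy => ⟨hy.1, ?_⟩).symm, (h.2 π₂ h₂ fun y hy => ⟨hy.1, ?_⟩).symm⟩
  all_goals
    have e₁ := h₁.2 y (subset_convexHull ℝ _ hy.1)
    have e₂ := h₂.2 y (subset_convexHull ℝ _ hy.1)
    have e := hy.2
    rw [hn] at e
    linarith

/-- Extreme functions are minimal. -/
theorem IsExtreme.eq_of_le (h : IsExtreme f S π) (h' : IsValid f S π') (hle : ∀ r, π' r ≤ π r) :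
    π' = π := by
  have h₀ := isValid_iff.1 h.1
  -- The reflection of `π'` through `π` lies above `π`, hence is valid.
  refine (h.2 π' (fun r => 2 * π r - π' r) h' (isValid_iff.2 ⟨fun r => ?_, fun n hn => ?_⟩)
    fun r => by ring).1.symm
  · linarith [h₀.1 r, hle r]
  · exact (h₀.2 n hn).trans (linearCombination_mono (fun r => by linarith [hle r]) n)

/-- A minimal function is bounded at `r` by its total over any combination congruent to `r`. -/
theorem IsExtreme.le_linearCombination (h : IsExtreme f S π) {r : G} {m : G →₀ ℕ}
    (hm : linearCombination ℕ id m - r ∈ S) : π r ≤ linearCombination ℕ π m := by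
  classical
  by_contra! hlt
  have h₀ := isValid_iff.1 h.1
  have hm0 : 0 ≤ linearCombination ℕ π m := by
    rw [Finsupp.linearCombination_apply]
    exact Finset.sum_nonneg fun x _ => nsmul_nonneg (h₀.1 x) _
  -- Replacing every copy of `r` in a solution by `m` gives a solution, so `π` may be lowered at `r`
  -- to the cost of `m`.
  have hv : IsValid f S (Function.update π r (linearCombination ℕ π m)) := by
    refine isValid_iff.2 ⟨fun x => ?_, fun n hn => ?_⟩
    · by_cases hx : x = r
      · subst hx; simpa using hm0
      · simpa [hx] using h₀.1 x
    · have := h₀.2 (n.erase r + n r • m) (by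
        rw [linearCombination_erase_add id n r] at hn
        rw [map_add, map_nsmul]
        have e := S.add_mem hn (S.nsmul_mem hm (n r))
        convert e using 1
        simp only [id, smul_sub]
        abel)
      rw [linearCombination_erase_add _ n r, linearCombination_update_erase,
        Function.update_self]
      rwa [map_add, map_nsmul] at this
  have := congrFun (h.eq_of_le hv fun x => ?_) r
  · simp only [Function.update_self] at this
    exact hlt.ne this
  · by_cases hx : x = r
    · subst hx; simpa using hlt.le
    · simp [hx]

theorem IsExtreme.nonneg (h : IsExtreme f S π) (r : G) : 0 ≤ π r := h.1.1 r

theorem IsExtreme.map_zero (h : IsExtreme f S π) : π 0 = 0 :=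
  le_antisymm (by simpa using h.le_linearCombination (r := 0) (m := 0) (by simp)) (h.nonneg 0)

theorem IsExtreme.map_add_le (h : IsExtreme f S π) (x y : G) : π (x + y) ≤ π x + π y := by
  have := h.le_linearCombination (r := x + y) (m := single x 1 + single y 1) (by simp)
  rw [map_add] at this
  simpa using this

theorem IsExtreme.map_add_mem (h : IsExtreme f S π) (x : G) {s : G} (hs : s ∈ S) :
    π (x + s) = π x := by
  apply le_antisymm
  · simpa using h.le_linearCombination (r := x + s) (m := single x 1) (by simpa using hs)
  · simpa using h.le_linearCombination (r := x) (m := single (x + s) 1) (by simpa using hs)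

/-- Extreme functions satisfy the symmetry condition. -/
theorem IsExtreme.symm (h : IsExtreme f S π) (v : G) : π v + π (f - v) = 1 := by
  classical
  have h₀ := isValid_iff.1 h.1
  have key : ∀ v, 1 < π v + π (f - v) → π v = 0 := by
    intro v hv
    set d := π v + π (f - v) with hd
    -- What remains of a solution after removing one `v` is congruent to `f - v`, so it costs at
    -- least `π (f - v)`.
    have hbound : ∀ n : G →₀ ℕ, linearCombination ℕ id n - f ∈ S → n v ≠ 0 →
        d ≤ linearCombination ℕ π n := by
      intro n hn hnv
      obtain ⟨m, rfl⟩ : ∃ m, n = m + single v 1 := by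
        refine ⟨n - single v 1, (tsub_add_cancel_of_le ?_).symm⟩
        rw [Finsupp.single_le_iff]
        omega
      have := h.le_linearCombination (r := f - v) (m := m) (by
        rw [map_add] at hn
        convert hn using 1
        simp only [Finsupp.linearCombination_single, one_smul, id]
        abel)
      rw [map_add, Finsupp.linearCombination_single, one_smul]
      linarith
    -- Solutions using `v` cost at least `d`, so even dividing all their coefficients by `d` would
    -- be harmless.
    have hval : IsValid f S (Function.update π v (π v / d)) := by
      refine isValid_iff.2 ⟨fun x => ?_, fun n hn => ?_⟩
      · by_cases hx : x = v
        · subst hx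
          simpa using div_nonneg (h₀.1 x) (by linarith)
        · simpa [hx] using h₀.1 x
      · rw [linearCombination_erase_add _ n v, linearCombination_update_erase,
          Function.update_self]
        have e := linearCombination_erase_add π n v
        by_cases hnv : n v = 0
        · have := h₀.2 n hn
          simp only [hnv, zero_smul, add_zero] at e ⊢
          rwa [← e]
        · have hb := hbound n hn hnv
          have hpos : 0 ≤ linearCombination ℕ π (n.erase v) := by
            rw [Finsupp.linearCombination_apply]
            exact Finset.sum_nonneg fun x _ => nsmul_nonneg (h₀.1 x) _
          have h1 : linearCombination ℕ π (n.erase v) / d ≤ linearCombination ℕ π (n.erase v) :=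
            div_le_self hpos hv.le
          have h2 : 1 ≤ linearCombination ℕ π n / d := by
            rw [le_div_iff₀ (by linarith)]
            linarith
          rw [e, add_div] at h2
          simp only [nsmul_eq_mul] at h2 ⊢
          rw [mul_div_assoc] at h2
          linarith
    have := congrFun (h.eq_of_le hval fun x => ?_) v
    · rw [Function.update_self, div_eq_iff (by linarith)] at this
      nlinarith
    · by_cases hx : x = v
      · subst hx
        simpa using div_le_self (h₀.1 x) hv.le
      · simp [hx]
  have hge : 1 ≤ π v + π (f - v) := by
    have := h₀.2 (single v 1 + single (f - v) 1) (by simp)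
    rw [map_add] at this
    simpa using this
  by_contra hne
  have hlt : 1 < π v + π (f - v) := lt_of_le_of_ne hge (Ne.symm hne)
  have e₁ := key v hlt
  have e₂ := key (f - v) (by rw [sub_sub_cancel, add_comm]; exact hlt)
  linarith

theorem IsExtreme.le_one (h : IsExtreme f S π) (v : G) : π v ≤ 1 := by
  linarith [h.symm v, h.nonneg (f - v)]

theorem IsExtreme.map_self (h : IsExtreme f S π) : π f = 1 := by
  simpa [h.map_zero] using h.symm 0

/-- Nonnegative subadditive `S`-periodic functions with value at least `1` at `f` are valid. -/
theorem isValid_of_subadditive (h₀ : ∀ r, 0 ≤ π r) (hz : π 0 = 0)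
    (hadd : ∀ x y, π (x + y) ≤ π x + π y) (hper : ∀ x, ∀ s ∈ S, π (x + s) = π x)
    (hf : 1 ≤ π f) : IsValid f S π := by
  refine isValid_iff.2 ⟨h₀, fun n hn => ?_⟩
  have hle : ∀ m : G →₀ ℕ, π (linearCombination ℕ id m) ≤ linearCombination ℕ π m := by
    have hs : ∀ (r : G) (k : ℕ), π (k • r) ≤ k • π r := by
      intro r k
      induction k with
      | zero => simp [hz]
      | succ k ih =>
        rw [succ_nsmul, succ_nsmul]
        exact (hadd _ _).trans (by gcongr)
    intro m
    induction m using Finsupp.induction with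
    | zero => simp [hz]
    | single_add r k m _ _ ih =>
      rw [map_add, map_add, Finsupp.linearCombination_single, Finsupp.linearCombination_single]
      exact (hadd _ _).trans (add_le_add (hs _ _) ih)
  calc 1 ≤ π f := hf
    _ = π (linearCombination ℕ id n) := by rw [← hper f _ hn, add_sub_cancel]
    _ ≤ _ := hle n

/-- A valid function tight wherever the extreme function `π` is tight satisfies the symmetry
condition. -/
theorem IsExtreme.symm_of_tightSet_subset (h : IsExtreme f S π)
    (ht : tightSet f S π ⊆ tightSet f S π') (v : G) : π' v + π' (f - v) = 1 := by
  have := (@ht ((single v 1 + single (f - v) 1 : G →₀ ℕ).mapRange Nat.cast Nat.cast_zero)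
    ⟨mem_feasible_iff.2 ⟨_, rfl, by simp⟩, by rw [lhs_mapRange]; simpa using h.symm v⟩).2
  rw [lhs_mapRange] at this
  simpa using this

/-- A valid function tight wherever the extreme function `π` is tight inherits the additivity
relations of `π`. -/
theorem IsExtreme.map_add_of_tightSet_subset (h : IsExtreme f S π)
    (ht : tightSet f S π ⊆ tightSet f S π') {x y : G} (hxy : π x + π y = π (x + y)) :
    π' x + π' y = π' (x + y) := by
  -- By symmetry, additivity at `x, y` makes this three-term solution tight.
  have := (@ht ((single x 1 + single y 1 + single (f - (x + y)) 1 : G →₀ ℕ).mapRange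
    Nat.cast Nat.cast_zero)
    ⟨mem_feasible_iff.2 ⟨_, rfl, by simp⟩, by
      rw [lhs_mapRange]; simpa [hxy] using h.symm (x + y)⟩).2
  rw [lhs_mapRange] at this
  have e := h.symm_of_tightSet_subset ht (x + y)
  simp only [map_add, Finsupp.linearCombination_single, one_smul] at this
  linarith

/-- A valid function tight wherever the extreme function `π` is tight is periodic modulo `S`. -/
theorem IsExtreme.periodic_of_tightSet_subset (h : IsExtreme f S π) (hv : IsValid f S π')
    (ht : tightSet f S π ⊆ tightSet f S π') (x : G) {s : G} (hs : s ∈ S) :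
    π' (x + s) = π' x := by
  have hzero : ∀ t ∈ S, π t = 0 := fun t ht => by
    rw [← zero_add t, h.map_add_mem 0 ht, h.map_zero]
  have h₀ : π' 0 = 0 := by
    have := h.map_add_of_tightSet_subset ht (x := 0) (y := 0) (by simp [h.map_zero])
    simpa using this
  have h₁ := h.map_add_of_tightSet_subset ht (x := s) (y := -s)
    (by simp [hzero _ hs, hzero _ (S.neg_mem hs), h.map_zero])
  rw [add_neg_cancel, h₀] at h₁
  have h₂ : π' s = 0 := by linarith [hv.1 s, hv.1 (-s)]
  have := h.map_add_of_tightSet_subset ht (x := x) (y := s)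
    (by simp [hzero _ hs, h.map_add_mem x hs])
  linarith

end Group

/-! ### Subadditivity of piecewise linear functions, triangle by triangle. -/

/-- `g` is affine on each interval `[k, k + 1]` with integer endpoints. -/
def AffineOnCells (g : ℝ → ℝ) : Prop :=
  ∀ (k : ℤ) (s : ℝ), 0 ≤ s → s ≤ 1 → g (k + s) = (1 - s) * g k + s * g (k + 1)

namespace AffineOnCells

variable {g : ℝ → ℝ}

/-- On the triangle `s + t ≤ 1` both arguments and their sum stay in one cell each, so the slack is
affine there: a barycentric combination of its vertex values. -/
theorem slack_lower (hg : AffineOnCells g) (i j : ℤ) {s t : ℝ} (hs : 0 ≤ s) (ht : 0 ≤ t)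
    (hst : s + t ≤ 1) :
    g (i + s) + g (j + t) - g (i + s + (j + t)) =
      (1 - s - t) * (g i + g j - g (i + j)) + s * (g (i + 1) + g j - g (i + j + 1)) +
        t * (g i + g (j + 1) - g (i + j + 1)) := by
  have h := hg (i + j) (s + t) (by linarith) hst
  push_cast at h
  rw [show (i : ℝ) + s + (j + t) = i + j + (s + t) by ring, h, hg i s hs (by linarith),
    hg j t ht (by linarith)]
  ring

/-- Reflection turns upper triangles, `s + t ≥ 1`, into lower ones. -/
theorem neg (hg : AffineOnCells g) : AffineOnCells fun x => g (-x) := by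
  intro k s h0 h1
  have h := hg (-k - 1) (1 - s) (by linarith) (by linarith)
  push_cast at h
  simp only
  rw [show -((k : ℝ) + s) = -k - 1 + (1 - s) by ring, h, show -(k : ℝ) - 1 + 1 = -k by ring,
    show -((k : ℝ) + 1) = -k - 1 by ring]
  ring

/-- An affine-on-cells function which is subadditive on the integers is subadditive. -/
theorem map_add_le (hg : AffineOnCells g) (h : ∀ i j : ℤ, g (i + j) ≤ g i + g j) (x y : ℝ) :
    g (x + y) ≤ g x + g y := by
  have low : ∀ {g : ℝ → ℝ}, AffineOnCells g → (∀ i j : ℤ, g (i + j) ≤ g i + g j) →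
      ∀ (i j : ℤ) (s t : ℝ), 0 ≤ s → 0 ≤ t → s + t ≤ 1 →
        g (i + s + (j + t)) ≤ g (i + s) + g (j + t) := by
    intro g hg h i j s t hs ht hst
    have e := hg.slack_lower i j hs ht hst
    have e₀ := h i j
    have e₁ := h (i + 1) j
    have e₂ := h i (j + 1)
    push_cast at e₁ e₂
    rw [show (i : ℝ) + 1 + j = i + j + 1 by ring] at e₁
    rw [← add_assoc] at e₂
    have p₀ := mul_nonneg (by linarith : 0 ≤ 1 - s - t) (sub_nonneg.2 e₀)
    have p₁ := mul_nonneg hs (sub_nonneg.2 e₁)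
    have p₂ := mul_nonneg ht (sub_nonneg.2 e₂)
    linarith
  rcases le_total (Int.fract x + Int.fract y) 1 with hst | hst
  · have := low hg h ⌊x⌋ ⌊y⌋ _ _ (Int.fract_nonneg x) (Int.fract_nonneg y) hst
    simpa only [Int.floor_add_fract] using this
  · have := low hg.neg (fun i j => by
      have := h (-i) (-j)
      push_cast at this
      rwa [neg_add]) (-⌊x⌋ - 1) (-⌊y⌋ - 1) (1 - Int.fract x) (1 - Int.fract y)
      (by linarith [Int.fract_lt_one x]) (by linarith [Int.fract_lt_one y]) (by linarith)
    push_cast at this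
    convert this using 2
    · rw [← Int.floor_add_fract x, ← Int.floor_add_fract y]; simp; ring
    · congr 1; nth_rw 1 [← Int.floor_add_fract x]; ring
    · congr 1; nth_rw 1 [← Int.floor_add_fract y]; ring

/-- A subadditive affine-on-cells function which is additive at a point of a lower triangle is
additive on the smallest face containing that point. -/
theorem additive_lower (hg : AffineOnCells g) (h : ∀ x y, g (x + y) ≤ g x + g y) (i j : ℤ)
    {s t : ℝ} (hs : 0 ≤ s) (ht : 0 ≤ t) (hst : s + t ≤ 1)
    (heq : g (i + s) + g (j + t) = g (i + s + (j + t))) {s' t' : ℝ} (hs' : 0 ≤ s') (ht' : 0 ≤ t')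
    (hst' : s' + t' ≤ 1) (h₁ : s = 0 → s' = 0) (h₂ : t = 0 → t' = 0)
    (h₃ : s + t = 1 → s' + t' = 1) :
    g (i + s') + g (j + t') = g (i + s' + (j + t')) := by
  have e := hg.slack_lower i j hs ht hst
  have e' := hg.slack_lower i j hs' ht' hst'
  have e₀ := sub_nonneg.2 (h i j)
  have e₁ := h (i + 1) j
  have e₂ := h i (j + 1)
  rw [show (i : ℝ) + 1 + j = i + j + 1 by ring] at e₁
  rw [← add_assoc] at e₂
  rw [← sub_nonneg] at e₁ e₂
  have p₀ := mul_nonneg (by linarith : 0 ≤ 1 - s - t) e₀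
  have p₁ := mul_nonneg hs e₁
  have p₂ := mul_nonneg ht e₂
  rw [heq, sub_self] at e
  -- The nonnegative terms sum to zero, so each vanishes: either the vertex slack is zero, or the
  -- barycentric coordinate is, and then it is zero at `(s', t')` too.
  have z₀ : (1 - s' - t') * (g i + g j - g (i + j)) = 0 := by
    rcases mul_eq_zero.1 (by linarith : (1 - s - t) * (g i + g j - g (i + j)) = 0) with hz | hz
    · rw [show 1 - s' - t' = 0 by linarith [h₃ (by linarith)], zero_mul]
    · rw [hz, mul_zero]
  have z₁ : s' * (g (i + 1) + g j - g (i + j + 1)) = 0 := by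
    rcases mul_eq_zero.1 (by linarith : s * (g (i + 1) + g j - g (i + j + 1)) = 0) with hz | hz
    · rw [h₁ hz, zero_mul]
    · rw [hz, mul_zero]
  have z₂ : t' * (g i + g (j + 1) - g (i + j + 1)) = 0 := by
    rcases mul_eq_zero.1 (by linarith : t * (g i + g (j + 1) - g (i + j + 1)) = 0) with hz | hz
    · rw [h₂ hz, zero_mul]
    · rw [hz, mul_zero]
  linarith

/-- Subdividing the cells. -/
theorem comp_div (hg : AffineOnCells g) {m : ℕ} (hm : 0 < m) :
    AffineOnCells fun x => g (x / m) := by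
  intro k s h0 h1
  have hm' : (0 : ℝ) < m := by exact_mod_cast hm
  have hmz : (0 : ℤ) < m := by exact_mod_cast hm
  set i := k / (m : ℤ)
  set a := k % (m : ℤ)
  have hk : (k : ℝ) = m * i + a := by exact_mod_cast (Int.mul_ediv_add_emod k m).symm
  have ha0 : (0 : ℝ) ≤ a := by exact_mod_cast Int.emod_nonneg k hmz.ne'
  have ha1 : (a : ℝ) + 1 ≤ m := by exact_mod_cast Int.emod_lt_of_pos k hmz
  have key : ∀ u : ℝ, 0 ≤ u → u ≤ 1 →
      g ((k + u) / m) = (1 - (a + u) / m) * g i + (a + u) / m * g (i + 1) := by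
    intro u hu0 hu1
    rw [← hg i ((a + u) / m) (by positivity) (by rw [div_le_one hm']; linarith), hk]
    congr 1
    field_simp
    ring
  have k0 := key 0 le_rfl zero_le_one
  have k1 := key 1 zero_le_one le_rfl
  rw [add_zero] at k0
  simp only
  rw [key s h0 h1, k0, k1]
  field_simp
  ring

end AffineOnCells

theorem IsContinuousPiecewiseLinear.affineOnCells {q : ℕ} (hq : 0 < q) {π : ℝ → ℝ}
    (hπ : IsContinuousPiecewiseLinear q π) : AffineOnCells fun x => π (x / q) := by
  intro k s h0 h1
  have hq' : (0 : ℝ) < q := by exact_mod_cast hq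
  obtain ⟨c, hc⟩ := hπ k
  have hmem : ∀ u : ℝ, 0 ≤ u → u ≤ 1 →
      ((k : ℝ) + u) / q ∈ Set.Icc ((k : ℝ) / q) (((k : ℝ) + 1) / q) := fun u hu0 hu1 =>
    ⟨by gcongr; linarith, by gcongr⟩
  have m0 := hmem 0 le_rfl zero_le_one
  rw [add_zero] at m0
  have e₁ := hc _ m0 _ (hmem s h0 h1)
  have e₂ := hc _ m0 _ (hmem 1 zero_le_one le_rfl)
  have d : ∀ u : ℝ, ((k : ℝ) + u) / q - k / q = u / q := fun u => by ring
  rw [d] at e₁ e₂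
  simp only
  have : c * (s / q) = s * (c * (1 / q)) := by ring
  rw [this, ← e₂] at e₁
  linarith

/-! ### Perturbations on a grid. -/

/-- The piecewise linear interpolation of a sequence indexed by the integers. -/
noncomputable def interpolate (a : ℤ → ℝ) (x : ℝ) : ℝ :=
  (1 - Int.fract x) * a ⌊x⌋ + Int.fract x * a (⌊x⌋ + 1)

@[simp] theorem interpolate_intCast (a : ℤ → ℝ) (k : ℤ) : interpolate a k = a k := by
  simp [interpolate]

theorem affineOnCells_interpolate (a : ℤ → ℝ) : AffineOnCells (interpolate a) := by
  intro k s h0 h1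
  have e : interpolate a (k + 1) = a (k + 1) := by exact_mod_cast interpolate_intCast a (k + 1)
  rcases h1.lt_or_eq with h1 | rfl
  · have hfl : ⌊(k : ℝ) + s⌋ = k := by
      rw [Int.floor_eq_iff]; constructor <;> linarith
    have hfr : Int.fract ((k : ℝ) + s) = s := by
      rw [Int.fract, hfl]; ring
    rw [e, interpolate_intCast]
    simp [interpolate, hfl, hfr]
  · ring

theorem AffineOnCells.eq_interpolate {g : ℝ → ℝ} (hg : AffineOnCells g) (x : ℝ) :
    g x = interpolate (fun k => g k) x := by
  have := hg ⌊x⌋ (Int.fract x) (Int.fract_nonneg x) (Int.fract_lt_one x).le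
  rw [Int.floor_add_fract] at this
  simpa [interpolate] using this

theorem mem_integers {x : ℝ} : x ∈ integers ↔ ∃ k : ℤ, (k : ℝ) = x := Iff.rfl

/-- A subadditive periodic sequence defines a valid function by interpolation. -/
theorem isValid_interpolate {N : ℕ} (hN : 0 < N) {F : ℤ} {a : ℤ → ℝ} (hz : a 0 = 0)
    (hadd : ∀ k l, a (k + l) ≤ a k + a l) (hper : ∀ k, a (k + N) = a k) (hF : 1 ≤ a F) :
    IsValid ((F : ℝ) / N) integers fun x => interpolate a (N * x) := by
  have hN' : (0 : ℝ) < N := by exact_mod_cast hN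
  have hmul : ∀ (k : ℤ) (m : ℕ), a (m * k) ≤ m * a k := by
    intro k m
    induction m with
    | zero => simp [hz]
    | succ m ih =>
      push_cast
      rw [add_mul, add_mul, one_mul, one_mul]
      exact (hadd _ _).trans (by linarith)
  have hp : ∀ k m : ℤ, a (k + N * m) = a k := by
    intro k m
    have := (show Function.Periodic a (N : ℤ) from hper).int_mul m k
    rwa [Int.cast_id, mul_comm] at this
  -- Periodicity and subadditivity give `0 = a (N * k) ≤ N * a k`.
  have ha : ∀ k, 0 ≤ a k := by
    intro k
    have h1 := hmul k N
    have h2 := hp 0 k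
    rw [zero_add, hz] at h2
    rw [h2] at h1
    exact nonneg_of_mul_nonneg_right h1 hN'
  refine isValid_of_subadditive (fun r => ?_) ?_ (fun x y => ?_) ?_ ?_
  · exact add_nonneg (mul_nonneg (by linarith [Int.fract_lt_one ((N : ℝ) * r)]) (ha _))
      (mul_nonneg (Int.fract_nonneg _) (ha _))
  · have := interpolate_intCast a 0
    simpa [hz] using this
  · rw [mul_add]
    refine (affineOnCells_interpolate a).map_add_le (fun i j => ?_) _ _
    rw [← Int.cast_add]
    simpa only [interpolate_intCast] using hadd i j
  · rintro x s hs
    obtain ⟨m, rfl⟩ := mem_integers.1 hs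
    have e : (N : ℝ) * (x + m) = N * x + ((N * m : ℤ) : ℝ) := by push_cast; ring
    rw [e]
    simp only [interpolate, Int.fract_add_intCast, Int.floor_add_intCast, hp]
    rw [add_right_comm, hp]
  · rw [mul_div_cancel₀ _ hN'.ne', interpolate_intCast]
    exact hF

/-- For an extreme function that is affine on the cells of the grid `(1/N)ℤ`, with `f` on the
grid, every periodic function on the grid which vanishes at `f` and satisfies all additivity
relations of the extreme function is zero. -/
theorem IsExtreme.grid_rigidity {N : ℕ} (hN : 0 < N) {F : ℤ} {π : ℝ → ℝ}
    (h : IsExtreme ((F : ℝ) / N) integers π) (hπ : AffineOnCells fun x => π (x / N))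
    {θ : ℤ → ℝ} (hper : ∀ k, θ (k + N) = θ k) (hF : θ F = 0)
    (hadd : ∀ k l : ℤ, π (k / N) + π (l / N) = π ((k + l : ℤ) / N) → θ k + θ l = θ (k + l))
    (k : ℤ) : θ k = 0 := by
  have hN' : (0 : ℝ) < N := by exact_mod_cast hN
  set p : ℤ → ℝ := fun k => π (k / N) with hp
  have hp0 : p 0 = 0 := by simp [hp, h.map_zero]
  have hpF : p F = 1 := h.map_self
  have hpadd : ∀ k l, p (k + l) ≤ p k + p l := by
    intro k l
    have := h.map_add_le ((k : ℝ) / N) (l / N)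
    rwa [← add_div, ← Int.cast_add] at this
  have hpper : ∀ k, p (k + N) = p k := by
    intro k
    have := h.map_add_mem ((k : ℝ) / N) (s := 1) (mem_integers.2 ⟨1, by simp⟩)
    simp only [hp]
    rw [← this]
    congr 1
    push_cast
    field_simp
  have hθ0 : θ 0 = 0 := by
    have := hadd 0 0 (by simp [h.map_zero])
    simpa using this
  -- By periodicity only finitely many pairs matter; where the slack of `p` is zero, so is that of
  -- `θ`.
  obtain ⟨ε, hε, hsmall⟩ : ∃ ε : ℝ, 0 < ε ∧ ∀ k l : ℤ,
      ε * |θ k + θ l - θ (k + l)| ≤ p k + p l - p (k + l) := by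
    have hfin : ∀ᶠ ε : ℝ in nhdsWithin 0 (Set.Ioi 0),
        ∀ c ∈ Finset.Ico (0 : ℤ) N ×ˢ Finset.Ico (0 : ℤ) N,
          ε * |θ c.1 + θ c.2 - θ (c.1 + c.2)| ≤ p c.1 + p c.2 - p (c.1 + c.2) := by
      rw [Filter.eventually_all_finset]
      rintro ⟨k, l⟩ -
      rcases (sub_nonneg.2 (hpadd k l)).eq_or_lt with h0 | h0
      · have := hadd k l (by simp only [hp] at h0; linarith)
        refine Filter.Eventually.of_forall fun ε => ?_
        simp only [← h0, this, sub_self, abs_zero, mul_zero, le_refl]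
      · have hc : Filter.Tendsto (fun ε : ℝ => ε * |θ k + θ l - θ (k + l)|)
            (nhdsWithin 0 (Set.Ioi 0)) (nhds 0) := by
          have : Continuous fun ε : ℝ => ε * |θ k + θ l - θ (k + l)| := by fun_prop
          have := this.tendsto 0
          rw [zero_mul] at this
          exact this.mono_left nhdsWithin_le_nhds
        exact (hc.eventually_lt_const h0).mono fun ε hε => hε.le
    obtain ⟨ε, hε₁, hε₂⟩ := (hfin.and self_mem_nhdsWithin).exists
    refine ⟨ε, hε₂, fun k l => ?_⟩
    have hNz : (0 : ℤ) < N := by exact_mod_cast hN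
    have red : ∀ a : ℤ → ℝ, (∀ k, a (k + N) = a k) → ∀ k l,
        a (k % N) = a k ∧ a (k % N + l % N) = a (k + l) := by
      intro a ha k l
      have hpa : ∀ k m : ℤ, a (k + N * m) = a k := by
        intro k m
        have := (show Function.Periodic a (N : ℤ) from ha).int_mul m k
        rwa [Int.cast_id, mul_comm] at this
      constructor
      · rw [← hpa (k % N) (k / N), Int.emod_add_mul_ediv]
      · rw [← hpa _ (k / N + l / N)]
        congr 1
        linarith [Int.emod_add_mul_ediv k N, Int.emod_add_mul_ediv l N]
    have := hε₁ (k % N, l % N) (by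
      simp [Int.emod_nonneg _ hNz.ne', Int.emod_lt_of_pos _ hNz])
    simpa only [(red θ hper k l).1, (red θ hper l l).1, (red θ hper k l).2, (red p hpper k l).1,
      (red p hpper l l).1, (red p hpper k l).2] using this
  have hval : ∀ δ : ℝ, |δ| ≤ ε →
      IsValid ((F : ℝ) / N) integers fun x => interpolate (fun k => p k + δ * θ k) (N * x) := by
    intro δ hδ
    refine isValid_interpolate hN (by simp [hp0, hθ0]) (fun k l => ?_)
      (fun k => by simp only [hpper, hper]) (by simp [hpF, hF])
    have h₁ := hsmall k l
    have h₂ : -(δ * (θ k + θ l - θ (k + l))) ≤ ε * |θ k + θ l - θ (k + l)| := by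
      refine (neg_le_abs _).trans ?_
      rw [abs_mul]
      gcongr
    linarith
  have hsum := (h.2 _ _ (hval ε (abs_of_pos hε).le) (hval (-ε) (by rw [abs_neg, abs_of_pos hε]))
    fun r => by
      have e := hπ.eq_interpolate (N * r)
      simp only [mul_div_cancel_left₀ _ hN'.ne'] at e
      rw [e]
      simp only [interpolate, hp]
      ring).1
  have := congrFun hsum (k / N)
  simp only [mul_div_cancel₀ _ hN'.ne', interpolate_intCast, hp] at this
  have : ε * θ k = 0 := by linarith
  exact (mul_eq_zero.1 this).resolve_left hε.ne'

/-! ### Perturbations between the grid points. -/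

/-- A bounded function additive on a triangle and vanishing at its corners is zero on its three
projections. -/
theorem eq_zero_of_additive_on_triangle {u v w : ℝ → ℝ} {M : ℝ} (hM : ∀ r, |w r| ≤ M)
    (h : ∀ s t, 0 ≤ s → 0 ≤ t → s + t ≤ 1 → u s + v t = w (s + t)) (hu : u 0 = 0) (hv : v 0 = 0)
    (hw : w 1 = 0) {s : ℝ} (h0 : 0 ≤ s) (h1 : s ≤ 1) : u s = 0 ∧ v s = 0 ∧ w s = 0 := by
  have huw : ∀ s, 0 ≤ s → s ≤ 1 → u s = w s := fun s h0 h1 => by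
    have := h s 0 h0 le_rfl (by linarith)
    rwa [hv, add_zero, add_zero] at this
  have hvw : ∀ s, 0 ≤ s → s ≤ 1 → v s = w s := fun s h0 h1 => by
    have := h 0 s le_rfl h0 (by linarith)
    rwa [hu, zero_add, zero_add] at this
  have hadd : ∀ s t, 0 ≤ s → 0 ≤ t → s + t ≤ 1 → w s + w t = w (s + t) := fun s t hs ht hst => by
    rw [← h s t hs ht hst, huw s hs (by linarith), hvw t ht (by linarith)]
  -- Some point of `[0, 1]` has twice the value: `2s`, or `2s - 1` when `s ≥ 1/2`, as `w 1 = 0`.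
  -- Hence any bound can be halved.
  have hbound : ∀ n : ℕ, ∀ s, 0 ≤ s → s ≤ 1 → |w s| ≤ M / 2 ^ n := by
    intro n
    induction n with
    | zero => intro s _ _; simpa using hM s
    | succ n ih =>
      intro s h0 h1
      obtain ⟨r, hr0, hr1, hr⟩ : ∃ r, 0 ≤ r ∧ r ≤ 1 ∧ w r = 2 * w s := by
        rcases le_total s (1 / 2) with hs | hs
        · refine ⟨s + s, by linarith, by linarith, ?_⟩
          rw [← hadd s s h0 h0 (by linarith)]; ring
        · refine ⟨s + s - 1, by linarith, by linarith, ?_⟩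
          have e₁ := hadd s (1 - s) h0 (by linarith) (by linarith)
          have e₂ := hadd (s + s - 1) (1 - s) (by linarith) (by linarith) (by linarith)
          rw [show s + (1 - s) = 1 by ring, hw] at e₁
          rw [show s + s - 1 + (1 - s) = s by ring] at e₂
          linarith
      have := ih r hr0 hr1
      rw [hr, abs_mul, abs_two] at this
      rw [pow_succ, ← div_div]
      linarith
  have hz : w s = 0 := by
    have hlim : Filter.Tendsto (fun n : ℕ => M / 2 ^ n) Filter.atTop (nhds 0) :=
      tendsto_const_nhds.div_atTop (tendsto_pow_atTop_atTop_of_one_lt one_lt_two)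
    exact abs_nonpos_iff.1 (ge_of_tendsto' hlim fun n => hbound n s h0 h1)
  exact ⟨by rw [huw s h0 h1, hz], by rw [hvw s h0 h1, hz], hz⟩

/-- One period of the zigzag with values `0, 1, 0, -1`. -/
def zigzag (a : ℤ) : ℝ := if a = 1 then 1 else if a = 3 then -1 else 0

open Classical in
/-- The function on the grid `(1/4)ℤ` that repeats the zigzag on the unit cells on which `ψ` does
not vanish and is zero elsewhere. -/
noncomputable def cellZigzag (ψ : ℝ → ℝ) (k : ℤ) : ℝ :=
  if ∃ s : ℝ, 0 ≤ s ∧ s ≤ 1 ∧ ψ (((k / 4 : ℤ) : ℝ) + s) ≠ 0 then zigzag (k % 4) else 0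

open Classical in
theorem cellZigzag_eq (ψ : ℝ → ℝ) (i : ℤ) {a : ℤ} (h0 : 0 ≤ a) (h4 : a < 4) :
    cellZigzag ψ (4 * i + a) =
      if ∃ s : ℝ, 0 ≤ s ∧ s ≤ 1 ∧ ψ ((i : ℝ) + s) ≠ 0 then zigzag a else 0 := by
  rw [cellZigzag, show (4 * i + a) / 4 = i by omega, show (4 * i + a) % 4 = a by omega]

theorem cellZigzag_eq_zero {ψ : ℝ → ℝ} {i : ℤ} (h : ∀ s : ℝ, 0 ≤ s → s ≤ 1 → ψ (i + s) = 0)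
    {a : ℤ} (h0 : 0 ≤ a) (h4 : a < 4) : cellZigzag ψ (4 * i + a) = 0 := by
  rw [cellZigzag_eq ψ i h0 h4, if_neg]
  rintro ⟨s, hs0, hs1, hs⟩
  exact hs (h s hs0 hs1)

/-- Additivity spreads to the smallest face containing the point. An edge makes `ψ` on one cell a
translate or a negated reflection of `ψ` on another, and the zigzag is odd under `a ↦ 4 - a`. A full
triangle forces `ψ = 0` on all three cells. At a vertex all zigzag values are zero. -/
theorem cellZigzag_add {g ψ : ℝ → ℝ} (hg : AffineOnCells g)
    (hsub : ∀ x y, g (x + y) ≤ g x + g y) {M : ℝ} (hM : ∀ x, |ψ x| ≤ M)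
    (hψ : ∀ x y, g x + g y = g (x + y) → ψ x + ψ y = ψ (x + y)) (hint : ∀ i : ℤ, ψ i = 0)
    (k l : ℤ) (hkl : g (k / 4) + g (l / 4) = g (k / 4 + l / 4)) :
    cellZigzag ψ k + cellZigzag ψ l = cellZigzag ψ (k + l) := by
  classical
  obtain ⟨i, a, ha0, ha4, rfl⟩ : ∃ i a : ℤ, 0 ≤ a ∧ a < 4 ∧ k = 4 * i + a :=
    ⟨k / 4, k % 4, by omega, by omega, by omega⟩
  obtain ⟨j, b, hb0, hb4, rfl⟩ : ∃ i a : ℤ, 0 ≤ a ∧ a < 4 ∧ l = 4 * i + a :=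
    ⟨l / 4, l % 4, by omega, by omega, by omega⟩
  have ha0' : (0 : ℝ) ≤ a := by exact_mod_cast ha0
  have hb0' : (0 : ℝ) ≤ b := by exact_mod_cast hb0
  have hq : ∀ i a : ℤ, ((4 * i + a : ℤ) : ℝ) / 4 = i + (a : ℝ) / 4 := fun i a => by
    push_cast; ring
  rw [hq, hq] at hkl
  have hsum : 4 * i + a + (4 * j + b) = 4 * (i + j) + (a + b) := by ring
  rcases le_or_gt (a + b) 4 with hab | hab
  · have hab' : (a : ℝ) + b ≤ 4 := by exact_mod_cast hab
    have face : ∀ s t : ℝ, 0 ≤ s → 0 ≤ t → s + t ≤ 1 → (a = 0 → s = 0) → (b = 0 → t = 0) →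
        (a + b = 4 → s + t = 1) → ψ (i + s) + ψ (j + t) = ψ (i + s + (j + t)) := by
      intro s t hs ht hst h₁ h₂ h₃
      refine hψ _ _ (hg.additive_lower hsub i j (by positivity) (by positivity) (by linarith) hkl
        hs ht hst (fun h => h₁ ?_) (fun h => h₂ ?_) (fun h => h₃ ?_))
      · have : (a : ℝ) = 0 := by linarith
        exact_mod_cast this
      · have : (b : ℝ) = 0 := by linarith
        exact_mod_cast this
      · have : (a : ℝ) + b = 4 := by linarith
        exact_mod_cast this
    by_cases hb : b = 0
    · subst hb
      have e : ∀ s : ℝ, 0 ≤ s → s ≤ 1 → (a = 0 → s = 0) →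
          ψ (((i + j : ℤ) : ℝ) + s) = ψ (i + s) := by
        intro s h0 h1 h2
        have := face s 0 h0 le_rfl (by linarith) h2 (fun _ => rfl) (by omega)
        rw [add_zero, hint, add_zero] at this
        rw [this]
        push_cast
        congr 1
        ring
      rw [hsum, cellZigzag_eq ψ i ha0 ha4, cellZigzag_eq ψ j le_rfl (by norm_num), add_zero,
        cellZigzag_eq ψ (i + j) ha0 ha4]
      by_cases ha : a = 0
      · subst ha; simp [zigzag]
      · rw [show zigzag 0 = 0 by simp [zigzag], ite_self, add_zero]
        refine if_congr (exists_congr fun s => ?_) rfl rfl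
        refine and_congr_right fun h0 => and_congr_right fun h1 => ?_
        rw [e s h0 h1 fun h => absurd h ha]
    by_cases ha : a = 0
    · subst ha
      have e : ∀ s : ℝ, 0 ≤ s → s ≤ 1 → ψ (((i + j : ℤ) : ℝ) + s) = ψ (j + s) := by
        intro s h0 h1
        have := face 0 s le_rfl h0 (by linarith) (fun _ => rfl) (fun h => absurd h hb) (by omega)
        rw [add_zero, hint, zero_add] at this
        rw [this]
        push_cast
        congr 1
        ring
      rw [hsum, zero_add, cellZigzag_eq ψ i le_rfl (by norm_num), cellZigzag_eq ψ j hb0 hb4,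
        cellZigzag_eq ψ (i + j) hb0 hb4]
      simp only [show zigzag 0 = 0 by simp [zigzag], ite_self, zero_add]
      refine if_congr (exists_congr fun s => ?_) rfl rfl
      refine and_congr_right fun h0 => and_congr_right fun h1 => ?_
      rw [e s h0 h1]
    -- Diagonal edge, then interior of the lower triangle.
    rcases hab.eq_or_lt with hab | hab
    · have e : ∀ s : ℝ, 0 ≤ s → s ≤ 1 → ψ (j + (1 - s)) = -ψ (i + s) := by
        intro s h0 h1
        have := face s (1 - s) h0 (by linarith) (by linarith) (fun h => absurd h ha)
          (fun h => absurd h hb) (fun _ => by ring)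
        rw [show (i : ℝ) + s + (j + (1 - s)) = ((i + j + 1 : ℤ) : ℝ) by push_cast; ring,
          hint] at this
        linarith
      have hcell : (∃ s : ℝ, 0 ≤ s ∧ s ≤ 1 ∧ ψ ((j : ℝ) + s) ≠ 0) ↔
          ∃ s : ℝ, 0 ≤ s ∧ s ≤ 1 ∧ ψ ((i : ℝ) + s) ≠ 0 := by
        constructor
        · rintro ⟨s, h0, h1, hs⟩
          refine ⟨1 - s, by linarith, by linarith, fun hz => hs ?_⟩
          have := e (1 - s) (by linarith) (by linarith)
          rwa [hz, neg_zero, sub_sub_cancel] at this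
        · rintro ⟨s, h0, h1, hs⟩
          exact ⟨1 - s, by linarith, by linarith, by rw [e s h0 h1]; exact neg_ne_zero.2 hs⟩
      rw [show 4 * i + a + (4 * j + b) = 4 * (i + j + 1) + 0 by omega,
        cellZigzag_eq ψ i ha0 ha4, cellZigzag_eq ψ j hb0 hb4,
        cellZigzag_eq ψ (i + j + 1) le_rfl (by norm_num), if_congr hcell rfl rfl]
      have hz : zigzag a + zigzag b = 0 := by
        obtain rfl : b = 4 - a := by omega
        interval_cases a <;> first | exact absurd rfl ha | norm_num [zigzag]
      simp only [show zigzag 0 = 0 by simp [zigzag], ite_self]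
      split_ifs
      · exact hz
      · simp
    · have hz := fun (s : ℝ) (h0 : 0 ≤ s) (h1 : s ≤ 1) =>
        eq_zero_of_additive_on_triangle (u := fun s => ψ (i + s)) (v := fun t => ψ (j + t))
          (w := fun r => ψ (((i + j : ℤ) : ℝ) + r)) (fun r => hM _)
          (fun s t hs ht hst => by
            rw [face s t hs ht hst (fun h => absurd h ha) (fun h => absurd h hb)
              (fun h => absurd h hab.ne)]
            push_cast
            congr 1
            ring)
          (by simpa using hint i) (by simpa using hint j)
          (by exact_mod_cast hint (i + j + 1)) h0 h1
      rw [hsum, cellZigzag_eq_zero (fun s h0 h1 => (hz s h0 h1).1) ha0 ha4,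
        cellZigzag_eq_zero (fun s h0 h1 => (hz s h0 h1).2.1) hb0 hb4,
        cellZigzag_eq_zero (fun s h0 h1 => (hz s h0 h1).2.2) (by omega) hab, add_zero]
  -- Since `a, b < 4`, the point is interior to the upper triangle, so there are no edge cases.
  · have hab' : (4 : ℝ) < a + b := by exact_mod_cast hab
    have ha4' : (a : ℝ) < 4 := by exact_mod_cast ha4
    have hb4' : (b : ℝ) < 4 := by exact_mod_cast hb4
    have hneg : ∀ (i : ℤ) (s : ℝ), -(((-i - 1 : ℤ) : ℝ) + s) = i + (1 - s) := fun i s => by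
      push_cast; ring
    have face : ∀ s t : ℝ, 0 ≤ s → 0 ≤ t → s + t ≤ 1 →
        ψ (i + (1 - s)) + ψ (j + (1 - t)) = ψ (i + (1 - s) + (j + (1 - t))) := by
      intro s t hs ht hst
      apply hψ
      have := hg.neg.additive_lower (fun x y => by rw [neg_add]; exact hsub _ _) (-i - 1) (-j - 1)
        (s := 1 - a / 4) (t := 1 - b / 4) (by linarith) (by linarith) (by linarith)
        (by
          simp only [neg_add (((-i - 1 : ℤ) : ℝ) + (1 - (a : ℝ) / 4)), hneg, sub_sub_cancel]
          exact hkl)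
        hs ht hst (fun h => by linarith) (fun h => by linarith) (fun h => by linarith)
      simpa only [neg_add (((-i - 1 : ℤ) : ℝ) + s), hneg] using this
    have hz := fun (s : ℝ) (h0 : 0 ≤ s) (h1 : s ≤ 1) =>
      eq_zero_of_additive_on_triangle (u := fun s => ψ (i + (1 - s)))
        (v := fun t => ψ (j + (1 - t)))
        (w := fun r => ψ (((i + j + 1 : ℤ) : ℝ) + (1 - r))) (fun r => hM _)
        (fun s t hs ht hst => by
          rw [face s t hs ht hst]
          push_cast
          congr 1
          ring)
        (by simpa using hint (i + 1)) (by simpa using hint (j + 1))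
        (by simpa using hint (i + j + 1)) (sub_nonneg.2 h1) (sub_le_self 1 h0)
    simp only [sub_sub_cancel] at hz
    rw [show 4 * i + a + (4 * j + b) = 4 * (i + j + 1) + (a + b - 4) by ring,
      cellZigzag_eq_zero (fun s h0 h1 => (hz s h0 h1).1) ha0 ha4,
      cellZigzag_eq_zero (fun s h0 h1 => (hz s h0 h1).2.1) hb0 hb4,
      cellZigzag_eq_zero (fun s h0 h1 => (hz s h0 h1).2.2) (by omega) (by omega), add_zero]

/-! ### The position of `f`, and the conclusion. -/

/-- For an extreme continuous piecewise linear function with breakpoints in `(1/q)ℤ`, the point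
`f` lies in `(1/q)ℤ`. -/
theorem IsExtreme.exists_grid {f : ℝ} {q : ℕ} (hq : 0 < q) {π : ℝ → ℝ}
    (h : IsExtreme f integers π) (hπ : AffineOnCells fun x => π (x / q)) :
    ∃ F : ℤ, f = (F : ℝ) / q := by
  have hq' : (0 : ℝ) < q := by exact_mod_cast hq
  by_contra! hne
  set i := ⌊f * q⌋
  set s := Int.fract (f * q) with hs
  have hfs : f * q = i + s := (Int.floor_add_fract _).symm
  have hs0 : 0 < s := by
    refine (Int.fract_nonneg _).lt_of_ne fun hz => hne i ?_
    rw [eq_div_iff hq'.ne', hfs, hs, ← hz, add_zero]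
  have hs1 : s < 1 := Int.fract_lt_one _
  -- The maximum 1 is attained inside a cell, so `π` is 1 on that cell; by symmetry `π` vanishes
  -- near 0.
  have hf1 : (1 - s) * π (i / q) + s * π ((i + 1) / q) = 1 := by
    have := hπ i s hs0.le hs1.le
    simp only at this
    rw [← this, ← hfs, mul_div_cancel_right₀ _ hq'.ne', h.map_self]
  have u₀ := h.le_one ((i : ℝ) / q)
  have u₁ := h.le_one (((i : ℝ) + 1) / q)
  have v₀ : π ((i : ℝ) / q) = 1 := by nlinarith
  have v₁ : π (((i : ℝ) + 1) / q) = 1 := by nlinarith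
  have hcell : ∀ r : ℝ, 0 ≤ r → r ≤ 1 → π ((i + r) / q) = 1 := by
    intro r h0 h1
    have := hπ i r h0 h1
    simp only at this
    rw [this, v₀, v₁]
    ring
  have hzero : ∀ r : ℝ, 0 ≤ r → r ≤ 1 → π ((s - r) / q) = 0 := by
    intro r h0 h1
    have e := h.symm ((i + r) / q)
    rw [hcell r h0 h1] at e
    have : f - (i + r) / q = (s - r) / q := by
      field_simp
      linarith
    rw [this] at e
    linarith
  have hmul : ∀ (x : ℝ) (n : ℕ), π (n * x) ≤ n * π x := by
    intro x n
    induction n with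
    | zero => simp [h.map_zero]
    | succ n ih =>
      push_cast
      rw [add_mul, add_mul, one_mul, one_mul]
      exact (h.map_add_le _ _).trans (by linarith)
  -- For such `n` the point `f / n` lies where `π` vanishes, and `π f ≤ n * π (f / n)` contradicts
  -- `π f = 1`.
  obtain ⟨n, hn⟩ := exists_nat_gt (|f * q| / min s (1 - s))
  have hmin : 0 < min s (1 - s) := lt_min hs0 (by linarith)
  have hn0 : (0 : ℝ) < n := lt_of_le_of_lt (by positivity) hn
  rw [div_lt_iff₀ hmin] at hn
  have habs : |f * q / n| ≤ min s (1 - s) := by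
    rw [abs_div, abs_of_pos hn0, div_le_iff₀ hn0]
    linarith
  have b := abs_le.1 habs
  have := hzero (s - f * q / n) (by linarith [min_le_left s (1 - s)])
    (by linarith [min_le_right s (1 - s)])
  have e : (s - (s - f * q / n)) / q = f / n := by field_simp; ring
  rw [e] at this
  have hm := hmul (f / n) n
  rw [this, mul_zero, mul_div_cancel₀ _ hn0.ne', h.map_self] at hm
  linarith

theorem IsExtreme.isFacet {f : ℝ} {q : ℕ} (hq : 0 < q) {π : ℝ → ℝ}
    (h : IsExtreme f integers π) (hπ : IsContinuousPiecewiseLinear q π) :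
    IsFacet f integers π := by
  classical
  refine ⟨h.1, fun π' hv ht => ?_⟩
  have hq' : (0 : ℝ) < q := by exact_mod_cast hq
  have hcells := hπ.affineOnCells hq
  obtain ⟨F, rfl⟩ := h.exists_grid hq hcells
  -- Rescaling by `q` turns the cells into unit intervals.
  set ψ : ℝ → ℝ := fun x => π' (x / q) - π (x / q) with hψdef
  have hadd : ∀ x y : ℝ, π (x / q) + π (y / q) = π ((x + y) / q) → ψ x + ψ y = ψ (x + y) := by
    intro x y hxy
    rw [add_div] at hxy
    have := h.map_add_of_tightSet_subset ht hxy
    simp only [hψdef, add_div]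
    linarith
  have hbound : ∀ x, |ψ x| ≤ 1 := by
    intro x
    have h₁ := h.symm_of_tightSet_subset ht (x / q)
    have h₂ := hv.1 ((F : ℝ) / q - x / q)
    have h₃ := hv.1 (x / q)
    have h₄ := h.nonneg (x / q)
    have h₅ := h.le_one (x / q)
    rw [abs_le]
    constructor <;> simp only [hψdef] <;> linarith
  have hper : ∀ x, ψ (x + q) = ψ x := by
    intro x
    have h1 : (1 : ℝ) ∈ integers := mem_integers.2 ⟨1, by simp⟩
    simp only [hψdef, add_div, div_self hq'.ne', h.periodic_of_tightSet_subset hv ht _ h1,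
      h.map_add_mem _ h1]
  have hψ0 : ψ 0 = 0 := by
    have := hadd 0 0 (by simp [h.map_zero])
    simpa using this
  have hψF : ψ F = 0 := by
    have h₁ := h.symm_of_tightSet_subset ht 0
    have h₂ : π' 0 = 0 := by simpa [hψdef, h.map_zero] using hψ0
    simp only [hψdef, h.map_self]
    rw [sub_zero] at h₁
    linarith
  have hgrid : ∀ x : ℝ, x / ((4 * q : ℕ) : ℝ) = x / 4 / q := fun x => by
    push_cast; rw [div_div]
  have hF4 : (F : ℝ) / q = ((4 * F : ℤ) : ℝ) / ((4 * q : ℕ) : ℝ) := by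
    push_cast; rw [mul_div_mul_left _ _ four_ne_zero]
  have rigid : ∀ θ : ℤ → ℝ, (∀ k, θ (k + 4 * q) = θ k) → θ (4 * F) = 0 →
      (∀ k l : ℤ, π (k / 4 / q) + π (l / 4 / q) = π ((k / 4 + l / 4) / q) →
        θ k + θ l = θ (k + l)) → ∀ k, θ k = 0 := by
    intro θ h₁ h₂ h₃
    rw [hF4] at h
    refine h.grid_rigidity (N := 4 * q) (by omega) ?_ (by simpa using h₁) h₂ fun k l hkl => ?_
    · have := hcells.comp_div (m := 4) (by norm_num)
      simpa only [hgrid, Nat.cast_ofNat] using this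
    · refine h₃ k l ?_
      simpa only [hgrid, Int.cast_add, add_div] using hkl
  have hquarter : ∀ k : ℤ, ψ (k / 4) = 0 := by
    refine rigid (fun k => ψ (k / 4)) (fun k => ?_) ?_ fun k l hkl => ?_
    · rw [← hper ((k : ℝ) / 4)]
      congr 1
      push_cast
      ring
    · rw [← hψF]
      congr 1
      push_cast
      ring
    · rw [hadd _ _ hkl]
      congr 1
      push_cast
      ring
  have hint : ∀ i : ℤ, ψ i = 0 := by
    intro i
    rw [← hquarter (4 * i)]
    congr 1
    push_cast
    ring
  have hzig : ∀ k, cellZigzag ψ k = 0 := by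
    refine rigid (cellZigzag ψ) (fun k => ?_) ?_ fun k l hkl => ?_
    · have e₁ : (k + 4 * q) / 4 = k / 4 + q := by omega
      have e₂ : (k + 4 * q) % 4 = k % 4 := by omega
      have e₃ : ∀ s : ℝ, ψ (((k / 4 + q : ℤ) : ℝ) + s) = ψ (((k / 4 : ℤ) : ℝ) + s) := fun s => by
        rw [← hper (((k / 4 : ℤ) : ℝ) + s)]
        congr 1
        push_cast
        ring
      rw [cellZigzag, cellZigzag, e₂]
      refine if_congr (exists_congr fun s => ?_) rfl rfl
      rw [e₁, e₃]
    · simp [cellZigzag, zigzag]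
    · exact cellZigzag_add hcells (fun x y => by rw [add_div]; exact h.map_add_le _ _) hbound hadd
        hint k l hkl
  have hψ : ∀ x, ψ x = 0 := by
    intro x
    by_contra hx
    -- Position 1 of the cell, where the zigzag takes the value 1.
    have := hzig (4 * ⌊x⌋ + 1)
    rw [cellZigzag_eq ψ ⌊x⌋ zero_le_one (by norm_num), if_pos] at this
    · simp [zigzag] at this
    · exact ⟨Int.fract x, Int.fract_nonneg x, (Int.fract_lt_one x).le, by
        rwa [Int.floor_add_fract]⟩
  funext r
  have := hψ (r * q)
  simp only [hψdef, mul_div_cancel_right₀ _ hq'.ne'] at this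
  linarith

end GroupProblem

theorem mainTheorem2 (f : ℝ) (hf : f ∉ GroupProblem.integers) (q : ℕ) (hq : 0 < q)
    (π : ℝ → ℝ) (hπ : GroupProblem.IsContinuousPiecewiseLinear q π) :
    GroupProblem.IsExtreme f GroupProblem.integers π ↔
      GroupProblem.IsFacet f GroupProblem.integers π :=
  ⟨fun h => h.isFacet hq hπ, fun h => h.isExtreme⟩
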